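/- **Setting.** Fix integers $n \ge 3$ and $1 \le k \le n$. A *Plackett–Luce (PL) instance* is a vector of pairwise distinct scores $\theta=(\theta_1,\dots,\theta_n)\in(0,1]^n$ with $\max_i\theta_i=1$ (the items carry arbitrary labels, so the scores need not be listed in decreasing order). In each round a (possibly randomized) sequential algorithm, knowing only the history of its plays and of the winners it has observed, either stops and outputs a ranking $\sigma$, i.e. a permutation of $[n]$ with $\sigma(i)$ the position of item $i$, or plays a subset $S\subseteq[n]$ with $|S|=k$. In the latter case it receives winner (WI) feedback: item $i\in S$ is returned with probability $\theta_i/\sum_{j\in S}\theta_j$, independently of the past given $S$. The *sample complexity* of the algorithm on $\theta$ is the expected number of rounds it plays before it stops. A ranking $\sigma$ is an *$\epsilon$-best ranking* for $\theta$ if there are no $i,j$ with $\sigma(i)>\sigma(j)$ and $\theta_i\ge\theta_j+\epsilon$. The algorithm is *$(\epsilon,\delta)$-PAC-Rank* if on every PL instance it stops after finitely many rounds with probability $1$ and its output is an $\epsilon$-best ranking with probability at least $1-\delta$. It is *symmetric* if for every PL instance $\theta$, every bijection $\phi:[n]\to[n]$ and every ranking $\sigma$, $$\Pr(\text{output}=\sigma\mid(\theta_1,\dots,\theta_n))=\Pr(\text{output}=\sigma\circ\phi\mid(\theta_{\phi(1)},\dots,\theta_{\phi(n)})).$$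 **Theorem.** For every $\delta_0\in(0,1)$ there is a constant $c>0$, depending only on $\delta_0$, such that the following holds for all integers $n\ge3$ with $n(1-\delta_0)>1$, all $1\le k\le n$, all $\epsilon\in(0,1/\sqrt8]$ and all $\delta\in(0,\delta_0]$: for every symmetric $(\epsilon,\delta)$-PAC-Rank algorithm $\mathcal A$ with WI feedback on $k$-subsets there is a PL instance $\theta$ on which the sample complexity of $\mathcal A$ is at least $$c\,\frac{n}{\epsilon^2}\ln\frac{n}{4\delta}.$$ (For instance, with $\delta_0=1/2$ there is an absolute constant $c$ that works for all $n\ge3$ and all $\delta\le1/2$. The bound does not depend on $k$.) -/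

import Mathlib

open scoped ENNReal

noncomputable section

namespace PLRank

/-- A ranking of the `n` items: `σ i` is the position of item `i`, position `0` being the best. -/
abbrev Ranking (n : ℕ) : Type := Equiv.Perm (Fin n)

/-- The subsets of exactly `k` items that the learner may play. -/
abbrev Query (n k : ℕ) : Type := {S : Finset (Fin n) // S.card = k}

/-- The played subsets and the observed winners so far, the most recent round first. -/
abbrev History (n k : ℕ) : Type := List (Query n k × Fin n)

/-- Admissible Plackett-Luce parameters: positive scores in `(0, 1]`, pairwise distinct, the largest
of them equal to `1`.  The items carry arbitrary labels, that is, the scores need not be listed in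
decreasing order. -/
structure IsPLInstance {n : ℕ} (θ : Fin n → ℝ) : Prop where
  pos : ∀ i, 0 < θ i
  le_one : ∀ i, θ i ≤ 1
  exists_eq_one : ∃ i, θ i = 1
  injective : Function.Injective θ

/-- Winner feedback: the probability that item `i` wins when the set `S` is played. -/
def winProb {n : ℕ} (θ : Fin n → ℝ) (S : Finset (Fin n)) (i : Fin n) : ℝ :=
  if i ∈ S then θ i / ∑ j ∈ S, θ j else 0

/-- `σ` is an `ε`-best ranking for the scores `θ`: no item is placed after an item whose score is
smaller by `ε` or more. -/
def IsEpsBestRanking {n : ℕ} (ε : ℝ) (θ : Fin n → ℝ) (σ : Ranking n) : Prop :=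
  ¬ ∃ i j : Fin n, σ j < σ i ∧ θ j + ε ≤ θ i

/-- A sequential, possibly randomized, ranking algorithm with winner feedback on `k`-subsets: after
each history it draws its next action, which is either to stop and output a ranking (`Sum.inl σ`)
or to play a `k`-subset (`Sum.inr S`). The conditional law of the action given the history is
arbitrary. -/
structure Algorithm (n k : ℕ) where
  next : History n k → PMF (Ranking n ⊕ Query n k)

namespace Algorithm

variable {n k : ℕ}

/-- The probability, under the scores `θ`, that the first rounds of the run are exactly `h`. -/
def historyProb (A : Algorithm n k) (θ : Fin n → ℝ) : History n k → ℝ≥0∞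
  | [] => 1
  | (S, i) :: h => historyProb A θ h * A.next h (Sum.inr S) * ENNReal.ofReal (winProb θ S.1 i)

/-- The probability that the algorithm stops (after finitely many rounds) and outputs `σ`. -/
def outputProb (A : Algorithm n k) (θ : Fin n → ℝ) (σ : Ranking n) : ℝ≥0∞ :=
  ∑' h : History n k, A.historyProb θ h * A.next h (Sum.inl σ)

/-- The sample complexity: the expected number `τ` of rounds played, computed as
`∑ₜ P(τ > t)`, where `P(τ > t)` is the sum, over the histories `h` of length `t`, of the
probability that `h` occurs and that a further subset is played after it. -/
def sampleComplexity (A : Algorithm n k) (θ : Fin n → ℝ) : ℝ≥0∞ :=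
  ∑' h : History n k, A.historyProb θ h * ∑ S : Query n k, A.next h (Sum.inr S)

open Classical in
/-- `(ε, δ)`-PAC-Rank: on every instance the algorithm stops with probability one, and its output is
an `ε`-best ranking with probability at least `1 - δ`. -/
def IsPACRank (A : Algorithm n k) (ε δ : ℝ) : Prop :=
  ∀ θ : Fin n → ℝ, IsPLInstance θ →
    ∑ σ : Ranking n, A.outputProb θ σ = 1 ∧
    ENNReal.ofReal (1 - δ) ≤
      ∑ σ : Ranking n, if IsEpsBestRanking ε θ σ then A.outputProb θ σ else 0

/-- Label invariance: when the items are relabelled so that item `i` gets the score `θ (φ i)`, the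
ranking `i ↦ σ (φ i)` is output as often as `σ` was before. -/
def IsSymmetric (A : Algorithm n k) : Prop :=
  ∀ θ : Fin n → ℝ, IsPLInstance θ → ∀ (φ : Equiv.Perm (Fin n)) (σ : Ranking n),
    A.outputProb θ σ = A.outputProb (fun i => θ (φ i)) (φ.trans σ)

end Algorithm

end PLRank

end

open scoped ENNReal

noncomputable section

namespace PLRank

open Finset

/-! ### Histories of bounded length -/

/-! Take scores `θ` with a top group `T` of about half the items, each at least `ε` above every
other item, and all scores within `2ε` of each other. Every `ε`-best ranking then places `T` first.
Exchanging one item of `T` with one outside gives `M`, of order `n²`, relabelled instances. By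
symmetry, `T` comes first on a relabelled instance as often as the exchanged set comes first on `θ`.
Under `θ` these events are disjoint and all of them are errors, so their probabilities add up to at
most `δ` (`sum_outP_swap_le`) and average at most `δ / M`. This average, rather than `δ` itself,
brings `ln n` into the bound.

A change of measure compares `θ` with all alternatives at once (`lower_bound_of_alternatives`); with
an exponent near `ln (M / δ)` the divergences of the runs must add up to order `n² ln (n / δ)`
(`exists_exponent` covers the remaining range). One play of a `k`-set contributes only `O(n ε²)` to
this total: an exchange costs `O(ε² / k)` for each played item it moves, and each item is moved by
at most `n` exchanges, so `k` cancels (`sum_winKL_swap_le`). Dividing gives the expected number of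
rounds. -/

/-- The histories of exactly `t` rounds. -/
def historiesOfLength (n k : ℕ) : ℕ → Finset (History n k)
  | 0 => {[]}
  | t + 1 => ((univ : Finset (Query n k × Fin n)) ×ˢ historiesOfLength n k t).map
      ⟨fun p => p.1 :: p.2, fun p q h => by
        simp only [List.cons.injEq] at h
        exact Prod.ext h.1 h.2⟩

lemma mem_historiesOfLength {n k : ℕ} (t : ℕ) (h : History n k) :
    h ∈ historiesOfLength n k t ↔ h.length = t := by
  induction t generalizing h with
  | zero => simp [historiesOfLength]
  | succ t ih =>
    cases h with
    | nil => simp [historiesOfLength]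
    | cons a h =>
      rw [historiesOfLength, mem_map]
      constructor
      · rintro ⟨⟨b, h'⟩, hb, he⟩
        obtain ⟨-, rfl⟩ := List.cons.inj he
        rw [List.length_cons, (ih _).1 (mem_product.1 hb).2]
      · intro hl
        exact ⟨(a, h), mem_product.2 ⟨mem_univ _, (ih h).2 (Nat.succ_injective hl)⟩, rfl⟩

lemma sum_historiesOfLength_succ {n k : ℕ} (t : ℕ) (f : History n k → ℝ) :
    ∑ h ∈ historiesOfLength n k (t + 1), f h =
      ∑ h ∈ historiesOfLength n k t, ∑ S : Query n k, ∑ i : Fin n, f ((S, i) :: h) := by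
  rw [historiesOfLength, sum_map, sum_product, sum_comm]
  refine sum_congr rfl fun h _ => ?_
  rw [Fintype.sum_prod_type]
  rfl

/-- The histories of fewer than `t` rounds. -/
def historiesBelow (n k t : ℕ) : Finset (History n k) :=
  (range t).biUnion (historiesOfLength n k)

lemma mem_historiesBelow {n k : ℕ} (t : ℕ) (h : History n k) :
    h ∈ historiesBelow n k t ↔ h.length < t := by
  simp [historiesBelow, mem_historiesOfLength]

lemma sum_historiesBelow {n k : ℕ} (t : ℕ) (f : History n k → ℝ) :
    ∑ h ∈ historiesBelow n k t, f h =
      ∑ s ∈ range t, ∑ h ∈ historiesOfLength n k s, f h := by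
  refine sum_biUnion fun s _ s' _ hs => ?_
  rw [Function.onFun, disjoint_left]
  intro h h1 h2
  rw [mem_historiesOfLength] at h1 h2
  exact hs (h1.symm.trans h2)

lemma tendsto_historiesBelow (n k : ℕ) :
    Filter.Tendsto (historiesBelow n k) Filter.atTop Filter.atTop := by
  refine Filter.tendsto_atTop_finset_of_monotone (fun s t hst h hh => ?_) fun h => ?_
  · rw [mem_historiesBelow] at hh ⊢
    exact hh.trans_le hst
  · exact ⟨h.length + 1, (mem_historiesBelow _ _).2 (Nat.lt_succ_self _)⟩

/-! ### Winner probabilities -/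

section WinProb

variable {n : ℕ} {θ θ' : Fin n → ℝ} {S : Finset (Fin n)}

lemma winProb_nonneg (hθ : ∀ i, 0 < θ i) (S : Finset (Fin n)) (i : Fin n) :
    0 ≤ winProb θ S i := by
  unfold winProb
  split_ifs
  · exact div_nonneg (hθ i).le (sum_nonneg fun j _ => (hθ j).le)
  · exact le_rfl

lemma sum_winProb (hθ : ∀ i, 0 < θ i) (hS : S.Nonempty) : ∑ i, winProb θ S i = 1 := by
  simp only [winProb, sum_ite_mem, univ_inter, ← sum_div]
  exact div_self (sum_pos (fun i _ => hθ i) hS).ne'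

/-- The Kullback-Leibler divergence between the winner feedbacks on `S` under `θ` and `θ'`. -/
def winKL (θ θ' : Fin n → ℝ) (S : Finset (Fin n)) : ℝ :=
  ∑ i, winProb θ S i * Real.log (winProb θ S i / winProb θ' S i)

/-- The product form also covers items outside `S`, where both probabilities vanish, so likelihood
ratios need no separate support condition. -/
lemma winProb_eq_mul_exp (hθ : ∀ i, 0 < θ i) (hθ' : ∀ i, 0 < θ' i) (S : Finset (Fin n))
    (i : Fin n) :
    winProb θ S i = winProb θ' S i * Real.exp (Real.log (winProb θ S i / winProb θ' S i)) := by
  by_cases hi : i ∈ S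
  · have hp : ∀ {η : Fin n → ℝ}, (∀ i, 0 < η i) → 0 < winProb η S i := by
      intro η hη
      rw [winProb, if_pos hi]
      exact div_pos (hη i) (sum_pos (fun j _ => hη j) ⟨i, hi⟩)
    rw [Real.exp_log (div_pos (hp hθ) (hp hθ')), mul_div_cancel₀ _ (hp hθ').ne']
  · simp [winProb, hi]

/-- The logarithm splits into the ratio of the normalisers and the ratio of the scores. Applying
`log x ≤ x - 1` to each factor separately makes the sum collapse to complete squares. -/
lemma winKL_le (hθ : ∀ i, 0 < θ i) (hθ' : ∀ i, 0 < θ' i) (hS : S.Nonempty) :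
    winKL θ θ' S ≤ (∑ i ∈ S, (θ i - θ' i) ^ 2 / θ' i) / ∑ i ∈ S, θ i := by
  have hW : 0 < ∑ i ∈ S, θ i := sum_pos (fun i _ => hθ i) hS
  have hW' : 0 < ∑ i ∈ S, θ' i := sum_pos (fun i _ => hθ' i) hS
  set W := ∑ i ∈ S, θ i
  set W' := ∑ i ∈ S, θ' i
  have hlog : ∀ {x : ℝ}, 0 < x → Real.log x ≤ x - 1 := fun hx => Real.log_le_sub_one_of_pos hx
  have key : ∀ i ∈ S, winProb θ S i * Real.log (winProb θ S i / winProb θ' S i) ≤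
      θ i / W * (W' / W - 1) + θ i / W * (θ i / θ' i - 1) := by
    intro i hi
    have e : winProb θ S i / winProb θ' S i = (W' / W) * (θ i / θ' i) := by
      rw [winProb, winProb, if_pos hi, if_pos hi]
      change θ i / W / (θ' i / W') = _
      have := (hθ' i).ne'
      field_simp
    have e2 : winProb θ S i = θ i / W := by rw [winProb, if_pos hi]
    rw [e, e2, Real.log_mul (div_pos hW' hW).ne' (div_pos (hθ i) (hθ' i)).ne', ← mul_add]
    exact mul_le_mul_of_nonneg_left
      (add_le_add (hlog (div_pos hW' hW)) (hlog (div_pos (hθ i) (hθ' i))))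
      (div_pos (hθ i) hW).le
  have h1 : winKL θ θ' S = ∑ i ∈ S, winProb θ S i * Real.log (winProb θ S i / winProb θ' S i) := by
    symm
    refine sum_subset (subset_univ _) fun i _ hi => ?_
    simp [winProb, hi]
  rw [h1]
  refine (sum_le_sum key).trans (le_of_eq ?_)
  rw [sum_add_distrib, ← sum_mul, ← sum_div, div_self hW.ne', one_mul]
  have h2 : W' / W - 1 = ∑ i ∈ S, (θ' i - θ i) / W := by
    rw [← sum_div, sum_sub_distrib, sub_div, div_self hW.ne']
  rw [h2, ← sum_add_distrib, sum_div]
  refine sum_congr rfl fun i _ => ?_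
  have := (hθ' i).ne'
  field_simp
  ring

end WinProb

/-! ### The law of the run -/

namespace Algorithm

variable {n k : ℕ} (A : Algorithm n k) (θ θ' : Fin n → ℝ)

/-- The real-valued probability of the history `h`. -/
def histP (h : History n k) : ℝ := (A.historyProb θ h).toReal

/-- The real-valued probability of the next action `a` after the history `h`. -/
def actP (h : History n k) (a : Ranking n ⊕ Query n k) : ℝ := (A.next h a).toReal

/-- The log-likelihood ratio of a history under `θ` and `θ'`. -/
def logRatio (θ θ' : Fin n → ℝ) : History n k → ℝ
  | [] => 0
  | (S, i) :: h => logRatio θ θ' h + Real.log (winProb θ S.1 i / winProb θ' S.1 i)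

variable {θ θ'}

lemma histP_nil : A.histP θ [] = 1 := by simp [histP, historyProb]

lemma histP_cons (hθ : ∀ i, 0 < θ i) (S : Query n k) (i : Fin n) (h : History n k) :
    A.histP θ ((S, i) :: h) = A.histP θ h * A.actP h (Sum.inr S) * winProb θ S.1 i := by
  simp [histP, historyProb, actP, ENNReal.toReal_ofReal (winProb_nonneg hθ S.1 i)]

lemma histP_nonneg (h : History n k) : 0 ≤ A.histP θ h := ENNReal.toReal_nonneg

lemma actP_nonneg (h : History n k) (a : Ranking n ⊕ Query n k) : 0 ≤ A.actP h a :=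
  ENNReal.toReal_nonneg

lemma next_ne_top (h : History n k) (a : Ranking n ⊕ Query n k) : A.next h a ≠ ⊤ :=
  PMF.apply_ne_top _ _

lemma sum_actP (h : History n k) :
    ∑ σ, A.actP h (Sum.inl σ) + ∑ S, A.actP h (Sum.inr S) = 1 := by
  have h1 : ∑ a, A.next h a = 1 := by
    rw [← (A.next h).tsum_coe, tsum_fintype]
  have h2 := congrArg ENNReal.toReal h1
  rw [ENNReal.toReal_sum (fun a _ => A.next_ne_top h a), Fintype.sum_sum_type] at h2
  simpa [actP] using h2

lemma historyProb_ne_top (h : History n k) : A.historyProb θ h ≠ ⊤ := by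
  induction h with
  | nil => simp [historyProb]
  | cons a h ih =>
    exact ENNReal.mul_ne_top (ENNReal.mul_ne_top ih (A.next_ne_top _ _)) ENNReal.ofReal_ne_top

lemma histP_eq_mul_exp (hθ : ∀ i, 0 < θ i) (hθ' : ∀ i, 0 < θ' i) (h : History n k) :
    A.histP θ h = A.histP θ' h * Real.exp (logRatio θ θ' h) := by
  induction h with
  | nil => simp [histP_nil, logRatio]
  | cons a h ih =>
    obtain ⟨S, i⟩ := a
    rw [A.histP_cons hθ, A.histP_cons hθ', logRatio, Real.exp_add, ih]
    conv_lhs => rw [winProb_eq_mul_exp hθ hθ']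
    ring

/-- The total mass of the run stopped after `t` rounds is one. -/
lemma sum_mass (hk : 1 ≤ k) (hθ : ∀ i, 0 < θ i) (t : ℕ) :
    ∑ h ∈ historiesBelow n k t, A.histP θ h * ∑ σ, A.actP h (Sum.inl σ) +
      ∑ h ∈ historiesOfLength n k t, A.histP θ h = 1 := by
  rw [sum_historiesBelow]
  induction t with
  | zero => simp [historiesOfLength, histP_nil]
  | succ t ih =>
    -- The mass at length `t` splits into runs that stop there and runs prolonged by one round.
    rw [sum_range_succ, sum_historiesOfLength_succ, ← ih, add_assoc, ← sum_add_distrib]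
    congr 1
    refine sum_congr rfl fun h _ => ?_
    have : ∑ S : Query n k, ∑ i, A.histP θ ((S, i) :: h) =
        A.histP θ h * ∑ S, A.actP h (Sum.inr S) := by
      rw [mul_sum]
      refine sum_congr rfl fun S _ => ?_
      simp_rw [A.histP_cons hθ]
      rw [← mul_sum, sum_winProb hθ (card_pos.1 (by rw [S.2]; exact hk)), mul_one]
    rw [this, ← mul_add, A.sum_actP, mul_one]

/-- The chain rule for the run stopped after `t` rounds. -/
lemma sum_logRatio (hk : 1 ≤ k) (hθ : ∀ i, 0 < θ i) (t : ℕ) :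
    ∑ h ∈ historiesBelow n k t, A.histP θ h * (∑ σ, A.actP h (Sum.inl σ)) * logRatio θ θ' h +
      ∑ h ∈ historiesOfLength n k t, A.histP θ h * logRatio θ θ' h =
    ∑ h ∈ historiesBelow n k t,
      A.histP θ h * ∑ S, A.actP h (Sum.inr S) * winKL θ θ' S.1 := by
  rw [sum_historiesBelow, sum_historiesBelow]
  induction t with
  | zero => simp [historiesOfLength, logRatio]
  | succ t ih =>
    rw [sum_range_succ, sum_range_succ, sum_historiesOfLength_succ, ← ih, add_assoc, add_assoc,
      ← sum_add_distrib, ← sum_add_distrib]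
    congr 1
    refine sum_congr rfl fun h _ => ?_
    have : ∑ S : Query n k, ∑ i, A.histP θ ((S, i) :: h) * logRatio θ θ' ((S, i) :: h) =
        A.histP θ h * (∑ S, A.actP h (Sum.inr S)) * logRatio θ θ' h +
          A.histP θ h * ∑ S, A.actP h (Sum.inr S) * winKL θ θ' S.1 := by
      rw [mul_sum, mul_sum, sum_mul, ← sum_add_distrib]
      refine sum_congr rfl fun S _ => ?_
      have h1 := sum_winProb hθ (card_pos.1 (by rw [S.2]; exact hk) : S.1.Nonempty)
      rw [winKL, mul_sum, mul_sum]
      calc _ = ∑ i, (A.histP θ h * A.actP h (Sum.inr S) * logRatio θ θ' h * winProb θ S.1 i +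
            A.histP θ h * (A.actP h (Sum.inr S) * (winProb θ S.1 i *
              Real.log (winProb θ S.1 i / winProb θ' S.1 i)))) := by
            refine sum_congr rfl fun i _ => ?_
            rw [A.histP_cons hθ, logRatio]
            ring
        _ = _ := by rw [sum_add_distrib, ← mul_sum, h1, mul_one]
    rw [this]
    linear_combination (A.histP θ h * logRatio θ θ' h) * A.sum_actP h

/-- The probability of stopping within fewer than `t` rounds with a ranking in `E`. -/
def stopP (θ : Fin n → ℝ) (E : Finset (Ranking n)) (t : ℕ) : ℝ :=
  ∑ h ∈ historiesBelow n k t, A.histP θ h * ∑ σ ∈ E, A.actP h (Sum.inl σ)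

/-- Fenchel–Young inequality `p f + p - q exp f ≤ p log (p / q)` with `q = y` and `p = y exp l`: a
termwise Donsker–Varadhan bound that remains valid at `y = 0`. -/
lemma mul_exp_ineq {y : ℝ} (hy : 0 ≤ y) (l f : ℝ) :
    y * Real.exp l * f + y * Real.exp l - y * Real.exp f ≤ y * Real.exp l * l := by
  have h1 := Real.add_one_le_exp (f - l)
  have h2 : Real.exp f = Real.exp l * Real.exp (f - l) := by rw [← Real.exp_add]; ring_nf
  have h3 : 0 ≤ y * Real.exp l := mul_nonneg hy (Real.exp_pos _).le
  rw [h2]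
  nlinarith [mul_le_mul_of_nonneg_left h1 h3]

/-- Change of measure for the run stopped after `t` rounds. -/
lemma change_of_measure (hk : 1 ≤ k) (hθ : ∀ i, 0 < θ i) (hθ' : ∀ i, 0 < θ' i)
    (E : Finset (Ranking n)) (lam : ℝ) (t : ℕ) :
    lam * A.stopP θ E t - (Real.exp lam - 1) * A.stopP θ' E t ≤
      ∑ h ∈ historiesBelow n k t,
        A.histP θ h * ∑ S, A.actP h (Sum.inr S) * winKL θ θ' S.1 := by
  rw [← A.sum_logRatio hk hθ]
  have m1 := A.sum_mass hk hθ t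
  have m2 := A.sum_mass hk hθ' t
  -- The test function is `lam` on stops in `E`, and `0` on other stops and on unfinished runs. The
  -- leftover masses cancel because both laws have total mass one.
  have key : ∀ h : History n k, A.histP θ h * lam * (∑ σ ∈ E, A.actP h (Sum.inl σ)) +
      A.histP θ h * (∑ σ, A.actP h (Sum.inl σ)) - A.histP θ' h * ((Real.exp lam - 1) *
        (∑ σ ∈ E, A.actP h (Sum.inl σ)) + ∑ σ, A.actP h (Sum.inl σ)) ≤
      A.histP θ h * (∑ σ, A.actP h (Sum.inl σ)) * logRatio θ θ' h := by
    intro h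
    have hc : ∑ σ ∈ Eᶜ, A.actP h (Sum.inl σ) =
        ∑ σ, A.actP h (Sum.inl σ) - ∑ σ ∈ E, A.actP h (Sum.inl σ) := by
      rw [← sum_add_sum_compl E]; ring
    have c0 : 0 ≤ ∑ σ ∈ Eᶜ, A.actP h (Sum.inl σ) := sum_nonneg fun _ _ => A.actP_nonneg _ _
    have c1 : 0 ≤ ∑ σ ∈ E, A.actP h (Sum.inl σ) := sum_nonneg fun _ _ => A.actP_nonneg _ _
    have i1 := mul_exp_ineq (A.histP_nonneg (θ := θ') h) (logRatio θ θ' h) lam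
    have i2 := mul_exp_ineq (A.histP_nonneg (θ := θ') h) (logRatio θ θ' h) 0
    rw [← A.histP_eq_mul_exp hθ hθ'] at i1 i2
    rw [Real.exp_zero] at i2
    have j1 := mul_le_mul_of_nonneg_right i1 c1
    have j2 := mul_le_mul_of_nonneg_right i2 c0
    rw [hc] at j2
    linarith
  have key2 : ∀ h : History n k, A.histP θ h - A.histP θ' h ≤ A.histP θ h * logRatio θ θ' h := by
    intro h
    have i2 := mul_exp_ineq (A.histP_nonneg (θ := θ') h) (logRatio θ θ' h) 0
    rw [← A.histP_eq_mul_exp hθ hθ', Real.exp_zero] at i2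
    linarith
  have s1 := sum_le_sum fun h (_ : h ∈ historiesBelow n k t) => key h
  have s2 := sum_le_sum fun h (_ : h ∈ historiesOfLength n k t) => key2 h
  rw [sum_sub_distrib] at s2
  have e : ∑ h ∈ historiesBelow n k t, (A.histP θ h * lam * (∑ σ ∈ E, A.actP h (Sum.inl σ)) +
      A.histP θ h * (∑ σ, A.actP h (Sum.inl σ)) - A.histP θ' h * ((Real.exp lam - 1) *
        (∑ σ ∈ E, A.actP h (Sum.inl σ)) + ∑ σ, A.actP h (Sum.inl σ))) =
      lam * A.stopP θ E t - (Real.exp lam - 1) * A.stopP θ' E t +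
      ∑ h ∈ historiesBelow n k t, A.histP θ h * ∑ σ, A.actP h (Sum.inl σ) -
      ∑ h ∈ historiesBelow n k t, A.histP θ' h * ∑ σ, A.actP h (Sum.inl σ) := by
    simp only [stopP, mul_sum (historiesBelow n k t), ← sum_add_distrib, ← sum_sub_distrib]
    refine sum_congr rfl fun h _ => ?_
    ring
  linarith

/-! ### Passing to the full run -/

/-- The probability that the output lies in `E`. -/
def outP (θ : Fin n → ℝ) (E : Finset (Ranking n)) : ℝ := ∑ σ ∈ E, (A.outputProb θ σ).toReal

lemma hasSum_outP (hfin : ∀ σ, A.outputProb θ σ ≠ ⊤) (E : Finset (Ranking n)) :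
    HasSum (fun h : History n k => A.histP θ h * ∑ σ ∈ E, A.actP h (Sum.inl σ))
      (A.outP θ E) := by
  simp_rw [mul_sum]
  refine hasSum_sum fun σ _ => ?_
  have h1 : ∀ h : History n k, A.historyProb θ h * A.next h (Sum.inl σ) ≠ ⊤ :=
    fun h => ENNReal.mul_ne_top (A.historyProb_ne_top h) (A.next_ne_top _ _)
  have h2 := ENNReal.hasSum_toReal (hfin σ)
  rw [← ENNReal.tsum_toReal_eq h1] at h2
  simpa [histP, actP, outputProb] using h2

lemma stopP_le_outP (hfin : ∀ σ, A.outputProb θ σ ≠ ⊤) (E : Finset (Ranking n)) (t : ℕ) :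
    A.stopP θ E t ≤ A.outP θ E :=
  sum_le_hasSum _ (fun _ _ => mul_nonneg (A.histP_nonneg _)
    (sum_nonneg fun _ _ => A.actP_nonneg _ _)) (A.hasSum_outP hfin E)

lemma tendsto_stopP (hfin : ∀ σ, A.outputProb θ σ ≠ ⊤) (E : Finset (Ranking n)) :
    Filter.Tendsto (A.stopP θ E) Filter.atTop (nhds (A.outP θ E)) :=
  (A.hasSum_outP hfin E).comp (tendsto_historiesBelow n k)

lemma sum_play_le_sampleComplexity (hfin : A.sampleComplexity θ ≠ ⊤) (t : ℕ) :
    ∑ h ∈ historiesBelow n k t, A.histP θ h * ∑ S, A.actP h (Sum.inr S) ≤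
      (A.sampleComplexity θ).toReal := by
  have h1 : ∑ h ∈ historiesBelow n k t, A.histP θ h * ∑ S, A.actP h (Sum.inr S) =
      (∑ h ∈ historiesBelow n k t,
        A.historyProb θ h * ∑ S : Query n k, A.next h (Sum.inr S)).toReal := by
    have hS : ∀ h, ∑ S : Query n k, A.next h (Sum.inr S) ≠ ⊤ := fun h =>
      ENNReal.sum_ne_top.2 fun S _ => A.next_ne_top _ _
    rw [ENNReal.toReal_sum fun h _ => ENNReal.mul_ne_top (A.historyProb_ne_top h) (hS h)]
    refine sum_congr rfl fun h _ => ?_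
    rw [ENNReal.toReal_mul, ENNReal.toReal_sum fun S _ => A.next_ne_top _ _]
    rfl
  rw [h1]
  exact ENNReal.toReal_mono hfin (ENNReal.sum_le_tsum _)

/-- Summing the change of measure over a family of alternatives whose divergences from `θ` add up
to at most `C` on every subset that may be played. -/
lemma lower_bound_of_alternatives (hk : 1 ≤ k) (hθ : ∀ i, 0 < θ i)
    (hout : ∀ σ, A.outputProb θ σ ≠ ⊤) (hfin : A.sampleComplexity θ ≠ ⊤)
    {ι : Type*} (P : Finset ι) (alt : ι → Fin n → ℝ) (halt : ∀ p i, 0 < alt p i)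
    (hout' : ∀ p σ, A.outputProb (alt p) σ ≠ ⊤) {C lam : ℝ} (hC : 0 ≤ C) (hlam : 0 ≤ lam)
    (hKL : ∀ S : Query n k, ∑ p ∈ P, winKL θ (alt p) S.1 ≤ C) (E : Finset (Ranking n)) :
    lam * P.card * A.outP θ E - (Real.exp lam - 1) * ∑ p ∈ P, A.outP (alt p) E ≤
      C * (A.sampleComplexity θ).toReal := by
  have he : 0 ≤ Real.exp lam - 1 := by linarith [Real.add_one_le_exp lam]
  have key : ∀ t, lam * P.card * A.stopP θ E t - (Real.exp lam - 1) * ∑ p ∈ P, A.outP (alt p) E ≤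
      C * (A.sampleComplexity θ).toReal := by
    intro t
    have h1 := sum_le_sum fun p (_ : p ∈ P) => A.change_of_measure hk hθ (halt p) E lam t
    rw [sum_sub_distrib, sum_const, nsmul_eq_mul, ← mul_sum] at h1
    have h2 : ∑ p ∈ P, A.stopP (alt p) E t ≤ ∑ p ∈ P, A.outP (alt p) E :=
      sum_le_sum fun p _ => A.stopP_le_outP (hout' p) E t
    -- Exchanging the sums collects all alternatives at a single query, where `hKL` applies.
    have h3 : ∑ p ∈ P, ∑ h ∈ historiesBelow n k t,
        A.histP θ h * ∑ S, A.actP h (Sum.inr S) * winKL θ (alt p) S.1 ≤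
        C * ∑ h ∈ historiesBelow n k t, A.histP θ h * ∑ S, A.actP h (Sum.inr S) := by
      rw [sum_comm, mul_sum]
      refine sum_le_sum fun h _ => ?_
      rw [← mul_sum, sum_comm, mul_left_comm, mul_sum univ _ C]
      refine mul_le_mul_of_nonneg_left (sum_le_sum fun S _ => ?_) (A.histP_nonneg h)
      rw [← mul_sum, mul_comm C]
      exact mul_le_mul_of_nonneg_left (hKL S) (A.actP_nonneg _ _)
    have h4 := mul_le_mul_of_nonneg_left (A.sum_play_le_sampleComplexity hfin t) hC
    have h5 := mul_le_mul_of_nonneg_left h2 he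
    linarith
  exact le_of_tendsto' (((A.tendsto_stopP hout E).const_mul _).sub_const _) key

end Algorithm

/-! ### The two-level instance -/

/-- Scores with the items below `m` in `(1 - ε / 2, 1]` and the others in `(1 - 2 ε, 1 - 3 ε / 2]`. -/
def twoLevel (n m : ℕ) (ε : ℝ) (x : Fin n) : ℝ :=
  1 - ε / 2 * ((x : ℕ) / n) - if (x : ℕ) < m then 0 else 3 * ε / 2

section TwoLevel

variable {n m : ℕ} {ε : ℝ}

lemma twoLevel_index_bounds (hε : 0 < ε) (x : Fin n) :
    0 ≤ ε / 2 * ((x : ℕ) / n) ∧ ε / 2 * ((x : ℕ) / n) < ε / 2 := by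
  have hn : (0 : ℝ) < n := by exact_mod_cast x.pos
  have hx : ((x : ℕ) : ℝ) < n := by exact_mod_cast x.2
  refine ⟨by positivity, ?_⟩
  have : ((x : ℕ) : ℝ) / n < 1 := (div_lt_one hn).2 hx
  nlinarith

lemma twoLevel_bounds (hε : 0 < ε) (x : Fin n) :
    1 - 2 * ε < twoLevel n m ε x ∧ twoLevel n m ε x ≤ 1 := by
  have := twoLevel_index_bounds hε x
  unfold twoLevel
  split_ifs <;> constructor <;> linarith

/-- The slope that separates the scores costs less than `ε / 2`, so the jump of `3ε / 2` leaves a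
gap of at least `ε`. -/
lemma twoLevel_add_le (hε : 0 < ε) {x y : Fin n} (hx : (x : ℕ) < m) (hy : ¬ (y : ℕ) < m) :
    twoLevel n m ε y + ε ≤ twoLevel n m ε x := by
  have h1 := twoLevel_index_bounds hε x
  have h2 := twoLevel_index_bounds hε y
  rw [twoLevel, twoLevel, if_pos hx, if_neg hy]
  linarith

lemma twoLevel_strictAnti (hε : 0 < ε) : StrictAnti (twoLevel n m ε) := by
  intro x y hxy
  have hn : (0 : ℝ) < n := by exact_mod_cast x.pos
  have hxy' : ((x : ℕ) : ℝ) < (y : ℕ) := by exact_mod_cast hxy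
  have h1 : ε / 2 * ((x : ℕ) / n) < ε / 2 * ((y : ℕ) / n) :=
    mul_lt_mul_of_pos_left (div_lt_div_of_pos_right hxy' hn) (by linarith)
  have h2 : (x : ℕ) < (y : ℕ) := hxy
  unfold twoLevel
  split_ifs <;> linarith

lemma isPLInstance_twoLevel (hε : 0 < ε) (hε' : ε ≤ 3 / 8) (hn : 0 < n) (hm : 0 < m) :
    IsPLInstance (twoLevel n m ε) where
  pos i := by linarith [(twoLevel_bounds (m := m) hε i).1]
  le_one i := (twoLevel_bounds hε i).2
  exists_eq_one := ⟨⟨0, hn⟩, by simp [twoLevel, hm]⟩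
  injective := (twoLevel_strictAnti hε).injective

lemma IsPLInstance.comp_perm {θ : Fin n → ℝ} (h : IsPLInstance θ) (φ : Equiv.Perm (Fin n)) :
    IsPLInstance fun i => θ (φ i) where
  pos i := h.pos _
  le_one i := h.le_one _
  exists_eq_one := by
    obtain ⟨i, hi⟩ := h.exists_eq_one
    exact ⟨φ.symm i, by simpa using hi⟩
  injective := h.injective.comp φ.injective

end TwoLevel

/-- If the scores lie in `[1 / 4, 1]` and vary by at most `d`, the divergences from `θ` to its
relabellings by the transpositions of an element of `T` with an element outside add up to at most
`16 n d²`. -/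
lemma sum_winKL_swap_le {n : ℕ} {θ : Fin n → ℝ} {d : ℝ} (hθ : ∀ i, 1 / 4 ≤ θ i)
    (hd : ∀ i j, (θ i - θ j) ^ 2 ≤ d ^ 2) (T : Finset (Fin n)) {S : Finset (Fin n)}
    (hS : S.Nonempty) :
    ∑ p ∈ T ×ˢ Tᶜ, winKL θ (fun x => θ (Equiv.swap p.1 p.2 x)) S ≤ 16 * n * d ^ 2 := by
  have hpos : ∀ i, 0 < θ i := fun i => lt_of_lt_of_le (by norm_num) (hθ i)
  have hk : (0 : ℝ) < S.card := by exact_mod_cast card_pos.2 hS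
  have hW : (S.card : ℝ) * (1 / 4) ≤ ∑ i ∈ S, θ i := by
    rw [← nsmul_eq_mul, ← sum_const]
    exact sum_le_sum fun i _ => hθ i
  have hone : ∀ p : Fin n × Fin n, winKL θ (fun x => θ (Equiv.swap p.1 p.2 x)) S ≤
      16 / S.card * ∑ x ∈ S, (θ x - θ (Equiv.swap p.1 p.2 x)) ^ 2 := by
    intro p
    refine (winKL_le hpos (fun i => hpos _) hS).trans ?_
    rw [div_le_iff₀ (sum_pos (fun i _ => hpos i) hS)]
    have h1 : ∑ x ∈ S, (θ x - θ (Equiv.swap p.1 p.2 x)) ^ 2 / θ (Equiv.swap p.1 p.2 x) ≤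
        4 * ∑ x ∈ S, (θ x - θ (Equiv.swap p.1 p.2 x)) ^ 2 := by
      rw [mul_sum]
      refine sum_le_sum fun x _ => ?_
      rw [div_le_iff₀ (hpos _)]
      nlinarith [hθ (Equiv.swap p.1 p.2 x), sq_nonneg (θ x - θ (Equiv.swap p.1 p.2 x))]
    refine h1.trans ?_
    set Q := ∑ x ∈ S, (θ x - θ (Equiv.swap p.1 p.2 x)) ^ 2
    have hQ : 0 ≤ Q := sum_nonneg fun _ _ => sq_nonneg _
    calc 4 * Q = 16 / S.card * Q * (S.card * (1 / 4)) := by field_simp; ring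
      _ ≤ _ := mul_le_mul_of_nonneg_left hW (by positivity)
  have hx : ∀ x : Fin n, ∑ p ∈ T ×ˢ Tᶜ, (θ x - θ (Equiv.swap p.1 p.2 x)) ^ 2 ≤ n * d ^ 2 := by
    intro x
    -- Only pairs containing `x` move it. Counting the two coordinates separately gives at most `|T|
    -- + |Tᶜ| = n` such pairs.
    have h1 : ∀ p : Fin n × Fin n, (θ x - θ (Equiv.swap p.1 p.2 x)) ^ 2 ≤
        (if p.1 = x then d ^ 2 else 0) + (if p.2 = x then d ^ 2 else 0) := by
      intro p
      by_cases h1 : p.1 = x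
      · rw [if_pos h1]
        exact (hd _ _).trans (le_add_of_nonneg_right (by split_ifs <;> positivity))
      by_cases h2 : p.2 = x
      · rw [if_neg h1, if_pos h2, zero_add]
        exact hd _ _
      · rw [Equiv.swap_apply_of_ne_of_ne (Ne.symm h1) (Ne.symm h2), if_neg h1, if_neg h2]
        simp
    have hite : ∀ U : Finset (Fin n), ∑ i ∈ U, (if i = x then d ^ 2 else 0) ≤ d ^ 2 := by
      intro U
      rw [sum_ite_eq']
      split_ifs
      · exact le_rfl
      · positivity
    refine (sum_le_sum fun p _ => h1 p).trans ?_
    rw [sum_add_distrib, sum_product_right, sum_product]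
    refine (add_le_add (sum_le_sum fun j _ => hite T) (sum_le_sum fun i _ => hite Tᶜ)).trans ?_
    rw [sum_const, sum_const, ← add_nsmul, add_comm, card_add_card_compl, Fintype.card_fin,
      nsmul_eq_mul]
  refine (sum_le_sum fun p _ => hone p).trans ?_
  rw [← mul_sum, sum_comm]
  calc 16 / (S.card : ℝ) * ∑ x ∈ S, ∑ p ∈ T ×ˢ Tᶜ, (θ x - θ (Equiv.swap p.1 p.2 x)) ^ 2
      ≤ 16 / (S.card : ℝ) * ∑ x ∈ S, (n * d ^ 2) :=
        mul_le_mul_of_nonneg_left (sum_le_sum fun x _ => hx x) (by positivity)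
    _ = 16 * n * d ^ 2 := by rw [sum_const, nsmul_eq_mul]; field_simp

/-! ### Rankings with a given set on top -/

/-- The rankings that place the items of `U` before all others. -/
def rankingsWithTop {n : ℕ} (U : Finset (Fin n)) : Finset (Ranking n) :=
  univ.filter fun σ => ∀ x ∈ U, ∀ y ∉ U, σ x < σ y

lemma mem_rankingsWithTop {n : ℕ} {U : Finset (Fin n)} {σ : Ranking n} :
    σ ∈ rankingsWithTop U ↔ ∀ x ∈ U, ∀ y ∉ U, σ x < σ y := by
  simp [rankingsWithTop]

/-- Distinct sets of equal size each contain an item that the other lacks, and these two items would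
have to precede each other. -/
lemma eq_of_mem_rankingsWithTop {n : ℕ} {U V : Finset (Fin n)} (hc : U.card = V.card)
    {σ : Ranking n} (hU : σ ∈ rankingsWithTop U) (hV : σ ∈ rankingsWithTop V) : U = V := by
  rw [mem_rankingsWithTop] at hU hV
  by_contra hne
  have h1 : ¬ U ⊆ V := fun h => hne (eq_of_subset_of_card_le h hc.ge)
  have h2 : ¬ V ⊆ U := fun h => hne (eq_of_subset_of_card_le h hc.le).symm
  obtain ⟨x, hx, hx'⟩ := not_subset.1 h1
  obtain ⟨y, hy, hy'⟩ := not_subset.1 h2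
  exact lt_asymm (hU x hx y hy') (hV y hy x hx')

lemma trans_mem_rankingsWithTop {n : ℕ} {U : Finset (Fin n)} {σ : Ranking n}
    (h : σ ∈ rankingsWithTop U) (φ : Equiv.Perm (Fin n)) :
    φ.trans σ ∈ rankingsWithTop (U.map φ.symm.toEmbedding) := by
  rw [mem_rankingsWithTop] at h ⊢
  intro x hx y hy
  rw [mem_map_equiv, Equiv.symm_symm] at hx hy
  exact h _ hx _ hy

lemma map_swap_ne {n : ℕ} {T : Finset (Fin n)} {i j : Fin n} (hi : i ∈ T) (hj : j ∉ T) :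
    T.map (Equiv.swap i j).symm.toEmbedding ≠ T := by
  intro h
  have : i ∈ T.map (Equiv.swap i j).symm.toEmbedding := by rwa [h]
  rw [mem_map_equiv, Equiv.symm_symm, Equiv.swap_apply_left] at this
  exact hj this

lemma map_swap_injOn {n : ℕ} {T : Finset (Fin n)} {i j i' j' : Fin n} (hi : i ∈ T) (hj : j ∉ T)
    (hi' : i' ∈ T) (hj' : j' ∉ T)
    (h : T.map (Equiv.swap i j).symm.toEmbedding = T.map (Equiv.swap i' j').symm.toEmbedding) :
    i = i' ∧ j = j' := by
  have key : ∀ x, Equiv.swap i j x ∈ T ↔ Equiv.swap i' j' x ∈ T := by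
    intro x
    have := Finset.ext_iff.1 h x
    simpa only [mem_map_equiv, Equiv.symm_symm] using this
  constructor
  · by_contra hne
    have h1 := (key i).not.1 (by rwa [Equiv.swap_apply_left])
    have hne' : i ≠ j' := fun e => hj' (e ▸ hi)
    rw [Equiv.swap_apply_of_ne_of_ne hne hne'] at h1
    exact h1 hi
  · by_contra hne
    have h1 := (key j).1 (by rwa [Equiv.swap_apply_right])
    have hne' : j ≠ i' := fun e => hj (e ▸ hi')
    rw [Equiv.swap_apply_of_ne_of_ne hne' hne] at h1
    exact hj h1

/-! ### Symmetry, correctness and the bound on a two-level instance -/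

namespace Algorithm

variable {n k : ℕ} (A : Algorithm n k) {θ : Fin n → ℝ}

/-- Symmetry turns each term into the probability, under `θ` itself, that an exchanged copy of `T`
is on top. A ranking has only one top set of a given size, and this set determines the exchanged
pair, so the events are disjoint. -/
lemma sum_outP_swap_le (hsym : A.IsSymmetric) (hθ : IsPLInstance θ) (T : Finset (Fin n)) :
    ∑ p ∈ T ×ˢ Tᶜ, A.outP (fun x => θ (Equiv.swap p.1 p.2 x)) (rankingsWithTop T) ≤
      A.outP θ (rankingsWithTop T)ᶜ := by
  have h1 : ∀ (p : Fin n × Fin n) (σ : Ranking n),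
      A.outputProb (fun x => θ (Equiv.swap p.1 p.2 x)) σ =
        A.outputProb θ ((Equiv.swap p.1 p.2).trans σ) := by
    intro p σ
    rw [hsym θ hθ (Equiv.swap p.1 p.2) ((Equiv.swap p.1 p.2).trans σ)]
    congr 1
    ext x
    simp
  simp only [outP, h1]
  rw [← sum_product (f := fun q : (Fin n × Fin n) × Ranking n =>
    (A.outputProb θ ((Equiv.swap q.1.1 q.1.2).trans q.2)).toReal)]
  have hinj : Set.InjOn (fun q : (Fin n × Fin n) × Ranking n =>
      (Equiv.swap q.1.1 q.1.2).trans q.2) ((T ×ˢ Tᶜ) ×ˢ rankingsWithTop T : Finset _) := by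
    rintro ⟨⟨i, j⟩, σ⟩ hq ⟨⟨i', j'⟩, τ⟩ hq' he
    simp only [coe_product, Set.mem_prod, mem_coe, mem_compl] at hq hq'
    simp only at he
    have hm := trans_mem_rankingsWithTop hq.2 (Equiv.swap i j)
    rw [he] at hm
    obtain ⟨rfl, rfl⟩ := map_swap_injOn hq.1.1 hq.1.2 hq'.1.1 hq'.1.2
      (eq_of_mem_rankingsWithTop (by simp) hm (trans_mem_rankingsWithTop hq'.2 _))
    have : σ = τ := by
      ext x
      have := Equiv.congr_fun he (Equiv.swap i j x)
      simpa using congrArg Fin.val this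
    rw [this]
  rw [← sum_image (f := fun σ => (A.outputProb θ σ).toReal) hinj]
  -- An exchange always alters `T`, so none of these rankings has `T` itself on top.
  refine sum_le_sum_of_subset_of_nonneg (fun ρ hρ => ?_) fun _ _ _ => ENNReal.toReal_nonneg
  obtain ⟨⟨⟨i, j⟩, σ⟩, hq, rfl⟩ := mem_image.1 hρ
  simp only [mem_product, mem_compl] at hq ⊢
  intro hmem
  exact map_swap_ne hq.1.1 hq.1.2 (eq_of_mem_rankingsWithTop (by simp)
    (trans_mem_rankingsWithTop hq.2 _) hmem)

lemma IsPACRank.outputProb_ne_top {A : Algorithm n k} {ε δ : ℝ} (h : A.IsPACRank ε δ)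
    (hθ : IsPLInstance θ) (σ : Ranking n) : A.outputProb θ σ ≠ ⊤ := by
  refine ENNReal.sum_ne_top.1 ?_ σ (mem_univ σ)
  rw [(h θ hθ).1]
  exact ENNReal.one_ne_top

lemma IsPACRank.outP_add_compl {A : Algorithm n k} {ε δ : ℝ} (h : A.IsPACRank ε δ)
    (hθ : IsPLInstance θ) (E : Finset (Ranking n)) : A.outP θ E + A.outP θ Eᶜ = 1 := by
  rw [outP, outP, sum_add_sum_compl, ← ENNReal.toReal_sum fun σ _ => h.outputProb_ne_top hθ σ,
    (h θ hθ).1, ENNReal.toReal_one]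

lemma IsPACRank.le_outP {A : Algorithm n k} {ε δ : ℝ} (h : A.IsPACRank ε δ)
    (hθ : IsPLInstance θ) {E : Finset (Ranking n)} (hE : ∀ σ, IsEpsBestRanking ε θ σ → σ ∈ E) :
    1 - δ ≤ A.outP θ E := by
  classical
  have h1 : ENNReal.ofReal (1 - δ) ≤ ∑ σ ∈ E, A.outputProb θ σ := by
    refine (h θ hθ).2.trans ?_
    rw [← sum_filter]
    refine sum_le_sum_of_subset fun σ hσ => hE σ ?_
    exact (mem_filter.1 hσ).2
  rw [outP, ← ENNReal.toReal_sum fun σ _ => h.outputProb_ne_top hθ σ]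
  exact (ENNReal.ofReal_le_iff_le_toReal
    (ENNReal.sum_ne_top.2 fun σ _ => h.outputProb_ne_top hθ σ)).1 h1

/-- The error budget `δ` is paid once for the whole family of `m (n - m)` alternatives, while the
gain `lam (1 - δ)` is collected from each of them. -/
lemma twoLevel_lower_bound {ε δ : ℝ} {m : ℕ} (hk : 1 ≤ k) (hm : 0 < m) (hmn : m ≤ n)
    (hε : 0 < ε) (hε' : ε ≤ 3 / 8) (hsym : A.IsSymmetric) (hpac : A.IsPACRank ε δ)
    (hfin : A.sampleComplexity (twoLevel n m ε) ≠ ⊤) {lam : ℝ} (hlam : 0 ≤ lam) :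
    lam * (m * (n - m)) * (1 - δ) - (Real.exp lam - 1) * δ ≤
      64 * n * ε ^ 2 * (A.sampleComplexity (twoLevel n m ε)).toReal := by
  have hn : 0 < n := hm.trans_le hmn
  have hPL := isPLInstance_twoLevel hε hε' hn hm
  set θ := twoLevel n m ε with hθdef
  set T : Finset (Fin n) := univ.filter fun x => (x : ℕ) < m with hT
  have hTcard : T.card = m := by rw [hT, Fin.card_filter_val_lt, min_eq_right hmn]
  have hP : ((T ×ˢ Tᶜ).card : ℝ) = m * (n - m) := by
    rw [card_product, card_compl, hTcard, Fintype.card_fin, Nat.cast_mul, Nat.cast_sub hmn]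
  have hKL : ∀ S : Query n k, ∑ p ∈ T ×ˢ Tᶜ,
      winKL θ (fun x => θ (Equiv.swap p.1 p.2 x)) S.1 ≤ 64 * n * ε ^ 2 := by
    intro S
    refine (sum_winKL_swap_le (d := 2 * ε) (fun i => ?_) (fun i j => ?_) T
      (card_pos.1 (by rw [S.2]; exact hk))).trans (le_of_eq (by ring))
    · linarith [(twoLevel_bounds (m := m) hε i).1]
    · have h1 := twoLevel_bounds (m := m) hε i
      have h2 := twoLevel_bounds (m := m) hε j
      rw [← hθdef] at h1 h2
      exact sq_le_sq' (by linarith) (by linarith)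
  have main := A.lower_bound_of_alternatives hk hPL.pos (hpac.outputProb_ne_top hPL) hfin
    (T ×ˢ Tᶜ) (fun p x => θ (Equiv.swap p.1 p.2 x)) (fun p i => hPL.pos _)
    (fun p => hpac.outputProb_ne_top (hPL.comp_perm _)) (by positivity) hlam hKL
    (rankingsWithTop T)
  have ha : 1 - δ ≤ A.outP θ (rankingsWithTop T) := by
    refine hpac.le_outP hPL fun σ hσ => mem_rankingsWithTop.2 fun x hx y hy => ?_
    by_contra hlt
    have hxm : (x : ℕ) < m := by simpa [hT] using hx
    have hym : ¬ (y : ℕ) < m := by simpa [hT] using hy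
    have hne : x ≠ y := fun e => hym (e ▸ hxm)
    exact hσ ⟨x, y, lt_of_le_of_ne (not_lt.1 hlt) fun e => hne (σ.injective e).symm,
      twoLevel_add_le hε hxm hym⟩
  have hb := A.sum_outP_swap_le hsym hPL T
  have hc := hpac.outP_add_compl hPL (rankingsWithTop T)
  have he : 0 ≤ Real.exp lam - 1 := by linarith [Real.add_one_le_exp lam]
  have hnm : (m : ℝ) ≤ n := by exact_mod_cast hmn
  have h0 : 0 ≤ lam * (m * (n - m)) :=
    mul_nonneg hlam (mul_nonneg (Nat.cast_nonneg _) (sub_nonneg.2 hnm))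
  rw [hP] at main
  have e1 := mul_le_mul_of_nonneg_left ha h0
  have e2 : (Real.exp lam - 1) * ∑ p ∈ T ×ˢ Tᶜ,
      A.outP (fun x => θ (Equiv.swap p.1 p.2 x)) (rankingsWithTop T) ≤ (Real.exp lam - 1) * δ :=
    mul_le_mul_of_nonneg_left (by linarith) he
  linarith

end Algorithm

/-- The exponent in the change of measure can be chosen so that the gain is of the order of the
logarithm, uniformly in `n` and `δ`. -/
lemma exists_exponent {δ₀ : ℝ} (h0 : 0 < δ₀) (h1 : δ₀ < 1) :
    ∃ c : ℝ, 0 < c ∧ ∀ (n : ℕ) (δ M : ℝ), 1 < (n : ℝ) * (1 - δ₀) → 0 < δ → δ ≤ δ₀ →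
      (n : ℝ) - 1 ≤ M → (n : ℝ) / 4 ≤ M →
      ∃ lam : ℝ, 0 ≤ lam ∧
        c * Real.log (n / (4 * δ)) ≤ lam * (1 - δ) - (Real.exp lam - 1) * (δ / M) := by
  set a := 1 - δ₀ with ha
  have ha0 : 0 < a := by linarith
  -- The condition `n (1 - δ₀) > 1` forces `n ≥ N + 1`, hence `M ≥ N`. So `b = δ₀ / N` bounds `δ /
  -- M` uniformly, and `(N + 1) a > 1` says exactly that `b < a`.
  set N := ⌊1 / a⌋₊ with hN
  have hN1 : (1 : ℝ) ≤ N := by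
    have : 1 ≤ N := Nat.le_floor (by rw [Nat.cast_one, le_div_iff₀ ha0]; linarith)
    exact_mod_cast this
  have hNa : 1 < (N + 1) * a := by
    have := Nat.lt_floor_add_one (1 / a)
    rwa [div_lt_iff₀ ha0] at this
  set b := δ₀ / N with hb
  have hb0 : 0 < b := by positivity
  have hba : b < a := by
    rw [hb, div_lt_iff₀ (by linarith)]
    linarith
  -- `l` maximises `lam * a - (exp lam - 1) * b`; the maximum `g` is positive because `b < a`.
  set l := Real.log (a / b) with hl
  have hl0 : 0 < l := Real.log_pos ((one_lt_div hb0).2 hba)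
  have hel : Real.exp l = a / b := Real.exp_log (div_pos ha0 hb0)
  set g := l * a - a + b with hg
  have hg0 : 0 < g := by
    have hne : b / a ≠ 1 := fun h => hba.ne ((div_eq_one_iff_eq ha0.ne').1 h)
    have h2 := Real.log_lt_sub_one_of_pos (div_pos hb0 ha0) hne
    rw [← inv_div, Real.log_inv, ← hl, inv_div] at h2
    have h3 := mul_lt_mul_of_pos_right h2 ha0
    rw [sub_mul, div_mul_cancel₀ _ ha0.ne'] at h3
    linarith
  refine ⟨min (a / 2) (g * a / 2), by positivity, ?_⟩
  intro n δ M hn hδ hδ' hM hM'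
  have hnN : (N : ℝ) + 1 ≤ n := by
    have : N < n := (Nat.floor_lt (by positivity)).2 (by rwa [div_lt_iff₀ ha0])
    exact_mod_cast this
  have hMN : (N : ℝ) ≤ M := by linarith
  have hM0 : 0 < M := by linarith
  have hn0 : (0 : ℝ) < n := by linarith
  set c := min (a / 2) (g * a / 2) with hc
  have hc0 : 0 < c := by positivity
  have hlog : Real.log (n / (4 * δ)) ≤ Real.log (M / δ) := by
    refine Real.log_le_log (by positivity) ?_
    rw [div_le_div_iff₀ (by positivity) hδ]
    nlinarith
  have hbM : δ / M ≤ b := by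
    rw [hb]
    exact div_le_div₀ h0.le hδ' (by linarith) hMN
  have hbM0 : 0 < δ / M := by positivity
  refine (?_ : ∃ lam : ℝ, 0 ≤ lam ∧
    c * Real.log (M / δ) ≤ lam * (1 - δ) - (Real.exp lam - 1) * (δ / M)).imp
    fun lam h => ⟨h.1, (mul_le_mul_of_nonneg_left hlog hc0.le).trans h.2⟩
  set L := Real.log (M / δ) with hL
  -- For large `L` the exponent `L` loses at most `1`, which is at most half of `L a`. For `L ≤ 2 /
  -- a` the fixed exponent `l` suffices, since `c L ≤ g`.
  rcases le_total (2 / a) L with hLa | hLa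
  · have hL0 : 0 ≤ L := le_trans (by positivity) hLa
    refine ⟨L, hL0, ?_⟩
    have he : Real.exp L * (δ / M) = 1 := by
      rw [hL, Real.exp_log (by positivity)]
      field_simp
    rw [sub_mul, he]
    rw [div_le_iff₀ ha0] at hLa
    have h2 : c * L ≤ a / 2 * L := mul_le_mul_of_nonneg_right (min_le_left _ _) hL0
    have h3 : L * a ≤ L * (1 - δ) := mul_le_mul_of_nonneg_left (by linarith) hL0
    linarith
  · refine ⟨l, hl0.le, ?_⟩
    rw [le_div_iff₀ ha0] at hLa
    have h2 : c * L ≤ g := by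
      rcases le_total L 0 with h | h
      · nlinarith
      · have : c * L ≤ g * a / 2 * L := mul_le_mul_of_nonneg_right (min_le_right _ _) h
        nlinarith
    have h3 : l * a ≤ l * (1 - δ) := mul_le_mul_of_nonneg_left (by linarith) hl0.le
    have h4 : (Real.exp l - 1) * (δ / M) ≤ (Real.exp l - 1) * b :=
      mul_le_mul_of_nonneg_left hbM (by linarith [Real.add_one_le_exp l])
    have h5 : (Real.exp l - 1) * b = a - b := by
      rw [hel, sub_mul, div_mul_cancel₀ _ hb0.ne', one_mul]
    linarith

/-- For odd `n` the product is `(n² - 1) / 4`. At `n = 3` it equals `2 = n - 1`, which still exceeds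
`9 / 5`. -/
lemma half_mul_half_bounds {n : ℕ} (hn : 3 ≤ n) :
    (n : ℝ) ^ 2 / 5 ≤ ((n / 2 : ℕ) : ℝ) * (n - (n / 2 : ℕ)) ∧
      (n : ℝ) - 1 ≤ ((n / 2 : ℕ) : ℝ) * (n - (n / 2 : ℕ)) := by
  have hn' : (3 : ℝ) ≤ n := by exact_mod_cast hn
  rcases Nat.even_or_odd' n with ⟨m, hm | hm⟩
  · have h : n / 2 = m := by omega
    have h' : (n : ℝ) = 2 * m := by rw [hm]; push_cast; ring
    rw [h, h']
    rw [h'] at hn'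
    constructor <;> nlinarith
  · have h : n / 2 = m := by omega
    have h' : (n : ℝ) = 2 * m + 1 := by rw [hm]; push_cast; ring
    rw [h, h']
    rw [h'] at hn'
    constructor <;> nlinarith

end PLRank

end

/-! ### Choice of constants and the theorem -/

theorem theorem3 :
    ∀ δ₀ : ℝ, 0 < δ₀ → δ₀ < 1 →
      ∃ c : ℝ, 0 < c ∧
        ∀ n k : ℕ, 3 ≤ n → 1 < (n : ℝ) * (1 - δ₀) → 1 ≤ k → k ≤ n →
          ∀ ε : ℝ, 0 < ε → ε ≤ 1 / Real.sqrt 8 →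
            ∀ δ : ℝ, 0 < δ → δ ≤ δ₀ →
              ∀ A : PLRank.Algorithm n k, A.IsSymmetric → A.IsPACRank ε δ →
                ∃ θ : Fin n → ℝ, PLRank.IsPLInstance θ ∧
                  ENNReal.ofReal (c * ((n : ℝ) / ε ^ 2) * Real.log ((n : ℝ) / (4 * δ))) ≤
                    A.sampleComplexity θ := by
  intro δ₀ h0 h1
  obtain ⟨c, hc, hex⟩ := PLRank.exists_exponent h0 h1
  -- `320 = 5 * 64`: there are at least `n² / 5` exchanges, and each play has total divergence at
  -- most `64 n ε²`.
  refine ⟨c / 320, by positivity, ?_⟩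
  intro n k hn hnδ hk _ ε hε hε8 δ hδ hδ' A hsym hpac
  -- This keeps all scores above `1 - 2ε ≥ 1 / 4`, as the divergence bound requires.
  have hε' : ε ≤ 3 / 8 := by
    refine hε8.trans ?_
    have h8 : 8 / 3 ≤ Real.sqrt 8 := Real.le_sqrt_of_sq_le (by norm_num)
    rw [div_le_iff₀ (by linarith)]
    linarith
  have hm : 0 < n / 2 := by omega
  refine ⟨PLRank.twoLevel n (n / 2) ε,
    PLRank.isPLInstance_twoLevel hε hε' (by omega) hm, ?_⟩
  by_cases hfin : A.sampleComplexity (PLRank.twoLevel n (n / 2) ε) = ⊤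
  · rw [hfin]
    exact le_top
  rw [ENNReal.ofReal_le_iff_le_toReal hfin]
  obtain ⟨hM2, hM1⟩ := PLRank.half_mul_half_bounds hn
  have hn' : (3 : ℝ) ≤ n := by exact_mod_cast hn
  have main := fun lam (hlam : 0 ≤ lam) =>
    A.twoLevel_lower_bound hk hm (Nat.div_le_self n 2) hε hε' hsym hpac hfin (lam := lam) hlam
  set M : ℝ := ((n / 2 : ℕ) : ℝ) * (n - (n / 2 : ℕ)) with hM
  have hM0 : 0 < M := by linarith
  obtain ⟨lam, hlam, hlog⟩ := hex n δ M hnδ hδ hδ' hM1 (by linarith)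
  set N := (A.sampleComplexity (PLRank.twoLevel n (n / 2) ε)).toReal
  set L := Real.log ((n : ℝ) / (4 * δ))
  have h2 : M * (c * L) ≤ 64 * n * ε ^ 2 * N := by
    refine (mul_le_mul_of_nonneg_left hlog hM0.le).trans (le_trans (le_of_eq ?_) (main lam hlam))
    field_simp
  rcases le_total L 0 with hL | hL
  · exact (mul_nonpos_of_nonneg_of_nonpos (by positivity) hL).trans ENNReal.toReal_nonneg
  · have h3 : (n : ℝ) ^ 2 / 5 * (c * L) ≤ 64 * n * ε ^ 2 * N :=
      (mul_le_mul_of_nonneg_right hM2 (by positivity)).trans h2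
    have hpos : (0 : ℝ) < 64 * n * ε ^ 2 := by positivity
    refine le_of_mul_le_mul_left (le_trans (le_of_eq ?_) h3) hpos
    field_simp
    ring
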